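/- Let $\mathfrak H$ be a complex Hilbert space with inner product $(\cdot,\cdot)$, let $J$ be a fundamental symmetry in $\mathfrak H$ (a bounded operator with $J=J^*$, $J^2=I$), and put $[x,y]=(Jx,y)$. Let $S$ be a closed densely defined symmetric operator in $\mathfrak H$ with $SJ=JS$. (Equalities such as $SJ=JS$ are equalities of unbounded operators, including the equality of their natural domains.) For $\mu\in\mathbb C\setminus\mathbb R$ let $\mathfrak N_\mu=\ker(S^*-\mu I)$. For $\mu\in\mathbb C_+=\{\mu:\operatorname{Im}\mu>0\}$ let $A_\mu$ be the restriction of $S^*$ to $\mathcal D(S)\dotplus\mathfrak N_\mu$, and let $$\mathsf{Sh}(\mu)=(A_\mu-iI)(A_\mu+iI)^{-1}\upharpoonright_{\mathfrak N_i}:\ \mathfrak N_i\to\mathfrak N_{-i}$$ be the characteristic function of $S$. Let $\mathfrak U$ be the set of all $C$-symmetries of $S$, i.e. of all bounded operators $C$ in $\mathfrak H$ with $C^2=I$, $JC>0$ (that is, $(JCx,x)>0$ for all $x\neq0$) and $SC=CS$. Let $\Upsilon_{\mathfrak U}$ be the set of all $J$-self-adjoint extensions $A\supset S$ (densely defined operators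 that contain $S$ and are equal to their adjoint with respect to $[\cdot,\cdot]$) such that $AC=CA$ for every $C\in\mathfrak U$. If there is a $\mu\in\mathbb C_+$ for which $\mathsf{Sh}(\mu)$ is boundedly invertible (a bounded bijection of $\mathfrak N_i$ onto $\mathfrak N_{-i}$ with bounded inverse), then $\Upsilon_{\mathfrak U}\neq\emptyset$. That is, there is a $J$-self-adjoint extension of $S$ that commutes with every $C$-symmetry of $S$. -/

import Mathlib

open scoped LinearPMap

noncomputable section

namespace KreinExt

variable {H : Type*} [NormedAddCommGroup H] [InnerProductSpace ℂ H]

/-! ### Generalities on unbounded operators -/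

/-- The composition `g f` of two unbounded operators on its natural domain
`{x ∈ D(f) | f x ∈ D(g)}`. -/
def pcomp (g f : H →ₗ.[ℂ] H) : H →ₗ.[ℂ] H :=
  g.comp (f.domRestrict ((g.domain.comap f.toFun).map f.domain.subtype)) (by
    rintro ⟨x, hx, hx'⟩
    obtain ⟨w, hw, rfl⟩ := hx
    exact hw)

/-- The operator `A - z I`, with domain `D(A)`. -/
def shift (A : H →ₗ.[ℂ] H) (z : ℂ) : H →ₗ.[ℂ] H :=
  (-(z • (LinearMap.id : H →ₗ[ℂ] H))) +ᵥ A

/-- `A C = C A` for an unbounded operator `A` and an everywhere defined bounded operator `C`,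
as an equality of unbounded operators: `D(AC) = {x | C x ∈ D(A)}` equals `D(CA) = D(A)`, and
`A C x = C A x` there. -/
def Commutes (A : H →ₗ.[ℂ] H) (C : H →L[ℂ] H) : Prop :=
  (∀ x : H, C x ∈ A.domain ↔ x ∈ A.domain) ∧
    ∀ (x : H) (hx : x ∈ A.domain) (hCx : C x ∈ A.domain), A ⟨C x, hCx⟩ = C (A ⟨x, hx⟩)

/-! ### Krein space notions -/

/-- `J` is a fundamental symmetry: `J = J*` and `J² = I`. -/
def IsFundamentalSymmetry [CompleteSpace H] (J : H →L[ℂ] H) : Prop :=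
  IsSelfAdjoint J ∧ J * J = 1

/-- The indefinite inner product `[x, y] = (J x, y)`, linear in the first variable `x` (Mathlib's
`inner ℂ a b` is linear in its second variable, so that the form `(a, b)` that is linear in the
first one is `inner ℂ b a`). -/
def krein (J : H →L[ℂ] H) (x y : H) : ℂ := inner ℂ y (J x)

/-- `A` is `J`-self-adjoint: `A` is densely defined and equals its adjoint with respect to
`[·,·]`, that is, `(y, z)` belongs to the graph of `A` if and only if `[A x, y] = [x, z]` for all
`x ∈ D(A)`. -/
def IsJSelfAdjoint (J : H →L[ℂ] H) (A : H →ₗ.[ℂ] H) : Prop :=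
  Dense (A.domain : Set H) ∧
    ∀ y z : H, (y, z) ∈ A.graph ↔ ∀ x : A.domain, krein J (A x) y = krein J (x : H) z

/-- The set `Σ_J` of all `J`-self-adjoint extensions of `S`. -/
def jSelfAdjointExtensions (J : H →L[ℂ] H) (S : H →ₗ.[ℂ] H) : Set (H →ₗ.[ℂ] H) :=
  {A | S ≤ A ∧ IsJSelfAdjoint J A}

/-- The set `𝔘` of all `C`-symmetries of `S`: the bounded operators `C` with `C² = I`, `J C > 0`
and `S C = C S`. -/
def cSymmetries (J : H →L[ℂ] H) (S : H →ₗ.[ℂ] H) : Set (H →L[ℂ] H) :=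
  {C | C * C = 1 ∧ ((J * C).IsPositive ∧ ∀ x : H, x ≠ 0 → 0 < (inner ℂ (J (C x)) x).re) ∧
    Commutes S C}

/-- The set `Υ_𝔘` of all `J`-self-adjoint extensions of `S` that commute with every
`C`-symmetry of `S`. -/
def upsilonU (J : H →L[ℂ] H) (S : H →ₗ.[ℂ] H) : Set (H →ₗ.[ℂ] H) :=
  {A | A ∈ jSelfAdjointExtensions J S ∧ ∀ C ∈ cSymmetries J S, Commutes A C}

/-! ### The characteristic function of a symmetric operator -/

variable [CompleteSpace H]

/-- The defect subspace `𝔑_μ = ker (S* - μ I)`. -/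
def defect (S : H →ₗ.[ℂ] H) (μ : ℂ) : Submodule ℂ H :=
  (LinearMap.ker (shift S† μ).toFun).map (shift S† μ).domain.subtype

/-- The extension `A_μ` of `S`: the restriction of `S*` to `D(S) ∔ 𝔑_μ`. -/
def dissExt (S : H →ₗ.[ℂ] H) (μ : ℂ) : H →ₗ.[ℂ] H :=
  S†.domRestrict (S.domain ⊔ defect S μ)

/-- The characteristic function `Sh(μ) = (A_μ - i I)(A_μ + i I)⁻¹ ↾ 𝔑_i`, `Im μ > 0`. -/
def charFun (S : H →ₗ.[ℂ] H) (μ : ℂ) : H →ₗ.[ℂ] H :=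
  (pcomp (shift (dissExt S μ) Complex.I) (shift (dissExt S μ) (-Complex.I)).inverse).domRestrict
    (defect S Complex.I)

/-- `Sh(μ) : 𝔑_i → 𝔑_{-i}` is boundedly invertible: it is a bounded bijection of `𝔑_i` onto
`𝔑_{-i}` with bounded inverse. -/
def CharFunBoundedlyInvertible (S : H →ₗ.[ℂ] H) (μ : ℂ) : Prop :=
  ∃ e : defect S Complex.I ≃L[ℂ] defect S (-Complex.I),
    ∀ x : defect S Complex.I, ((x : H), (e x : H)) ∈ (charFun S μ).graph

end KreinExt

end

open scoped LinearPMap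
open ContinuousLinearMap (adjoint)

/-! If `C` and `C*` both preserve the graph of `S`, then `C` preserves the graph of `S*`, the defect
subspaces and the graph of `A_μ`, so `Sh(μ)` intertwines the restrictions of `C` to `𝔑_i` and
`𝔑_{-i}` (`charFun_intertwines`). The same holds for `C*`. Hence the unitary factor `U = T
(T*T)^{-1/2}` of the invertible `T = Sh(μ)` has this property too (`exists_unitary_intertwining`).
By von Neumann's theory `U` yields a self-adjoint extension `A` on `D(S) + {n + U n}`, and `A`
commutes with every involution `C` of this kind. This covers `J`, which turns self-adjointness of
`A` into `J`-self-adjointness. It covers each `C`-symmetry as well: `J C` is self-adjoint, so `C* =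
J C J` also preserves `S`. -/

namespace KreinExt

/-! ### Polar decomposition of an invertible operator. -/

section Polar

variable {K L : Type*} [NormedAddCommGroup K] [InnerProductSpace ℂ K] [CompleteSpace K]
  [NormedAddCommGroup L] [InnerProductSpace ℂ L] [CompleteSpace L]

/-- The unitary factor of the polar decomposition of an invertible operator intertwines every pair
of operators that, together with the pair of their adjoints, is intertwined by the operator. -/
theorem exists_unitary_intertwining (T : K ≃L[ℂ] L) :
    ∃ U : K →L[ℂ] L, (∀ x y, inner ℂ (U x) (U y) = inner ℂ x y) ∧ Function.Surjective U ∧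
      ∀ (a : K →L[ℂ] K) (b : L →L[ℂ] L), (∀ x, T (a x) = b (T x)) →
        (∀ x, T (adjoint a x) = adjoint b (T x)) → ∀ x, U (a x) = b (U x) := by
  set t : K →L[ℂ] L := T.toContinuousLinearMap with ht
  set P : K →L[ℂ] K := adjoint t ∘L t with hP
  have hP0 : 0 ≤ P := by
    rw [ContinuousLinearMap.nonneg_iff_isPositive]
    exact ContinuousLinearMap.isPositive_adjoint_comp_self t
  have hts : t ∘L T.symm.toContinuousLinearMap = ContinuousLinearMap.id ℂ L := by ext; simp [ht]
  have hst : T.symm.toContinuousLinearMap ∘L t = ContinuousLinearMap.id ℂ K := by ext; simp [ht]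
  have hPu : IsUnit P := by
    refine ⟨⟨P, T.symm.toContinuousLinearMap ∘L adjoint T.symm.toContinuousLinearMap, ?_, ?_⟩, rfl⟩
    · calc adjoint t ∘L (t ∘L T.symm.toContinuousLinearMap) ∘L adjoint T.symm.toContinuousLinearMap
          = adjoint (T.symm.toContinuousLinearMap ∘L t) := by
            rw [hts, ContinuousLinearMap.id_comp, ContinuousLinearMap.adjoint_comp]
        _ = 1 := by rw [hst]; exact star_one (K →L[ℂ] K)
    · calc T.symm.toContinuousLinearMap ∘L (adjoint T.symm.toContinuousLinearMap ∘L adjoint t) ∘L t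
          = T.symm.toContinuousLinearMap ∘L t := by
            rw [← ContinuousLinearMap.adjoint_comp, hts,
              show adjoint (ContinuousLinearMap.id ℂ L) = ContinuousLinearMap.id ℂ L from
                star_one (L →L[ℂ] L), ContinuousLinearMap.id_comp]
        _ = 1 := hst
  -- With `P = T*T`, the identity `R P R = 1` makes `T R` isometric, and it is onto because `R` is
  -- invertible.
  set R : K →L[ℂ] K := P ^ (-(1 / 2) : ℝ) with hR
  have hRu : IsUnit R := hPu.cfcRpow _ hP0
  have hRa : adjoint R = R :=
    (IsSelfAdjoint.of_nonneg (CFC.rpow_nonneg : 0 ≤ R)).star_eq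
  have hRPR : R * P * R = 1 := by
    calc R * P * R = P ^ (-(1 / 2) : ℝ) * P ^ (1 : ℝ) * P ^ (-(1 / 2) : ℝ) := by
          rw [CFC.rpow_one P hP0]
      _ = P ^ (0 : ℝ) := by
          rw [← CFC.rpow_add hPu, ← CFC.rpow_add hPu]
          norm_num
      _ = 1 := CFC.rpow_zero P hP0
  refine ⟨t ∘L R, fun x y => ?_, ?_, fun a b hab hab' x => ?_⟩
  · have : inner ℂ (t (R x)) (t (R y)) = inner ℂ x ((R * P * R) y) := by
      rw [← ContinuousLinearMap.adjoint_inner_right, ← ContinuousLinearMap.adjoint_inner_right, hRa]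
      rfl
    simpa [hRPR] using this
  · intro y
    obtain ⟨u, hu⟩ := hRu
    refine ⟨(↑u⁻¹ : K →L[ℂ] K) (T.symm y), ?_⟩
    have : R ((↑u⁻¹ : K →L[ℂ] K) (T.symm y)) = T.symm y := by
      rw [← hu, ← mul_apply_eq_comp, Units.mul_inv]; rfl
    simp [this, ht]
  · have h1 : t ∘L a = b ∘L t := by ext x; exact hab x
    have h2 : adjoint t ∘L b = a ∘L adjoint t := by
      have : t ∘L adjoint a = adjoint b ∘L t := by ext x; exact hab' x
      simpa [ContinuousLinearMap.adjoint_comp] using (congrArg adjoint this).symm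
    -- `T*T a = T* b T = a T*T`; the functional calculus then passes commutation with `a` on to `R`.
    have hc : Commute P a := by
      change (adjoint t ∘L t) ∘L a = a ∘L (adjoint t ∘L t)
      rw [ContinuousLinearMap.comp_assoc, h1, ← ContinuousLinearMap.comp_assoc, h2,
        ContinuousLinearMap.comp_assoc]
    have hRc : Commute R a := hc.cfc_nnreal _
    have h3 : R (a x) = a (R x) := DFunLike.congr_fun hRc.eq x
    change t (R (a x)) = b (t (R x))
    rw [h3]
    exact hab _

end Polar

variable {H : Type*} [NormedAddCommGroup H] [InnerProductSpace ℂ H]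

/-! ### Graphs of unbounded operators. -/

section Graphs

theorem mem_shift_graph {A : H →ₗ.[ℂ] H} {z : ℂ} {x y : H} :
    (x, y) ∈ (shift A z).graph ↔ (x, y + z • x) ∈ A.graph := by
  simp only [LinearPMap.mem_graph_iff]
  constructor
  · rintro ⟨w, rfl, rfl⟩
    refine ⟨w, rfl, ?_⟩
    change A w = (-(z • (w : H)) + A w) + z • (w : H)
    abel
  · rintro ⟨w, rfl, h⟩
    refine ⟨w, rfl, ?_⟩
    change -(z • (w : H)) + A w = y
    rw [h]; abel

theorem mem_domRestrict_graph {A : H →ₗ.[ℂ] H} {V : Submodule ℂ H} {x y : H} :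
    (x, y) ∈ (A.domRestrict V).graph ↔ x ∈ V ∧ (x, y) ∈ A.graph := by
  simp only [LinearPMap.mem_graph_iff]
  constructor
  · rintro ⟨w, rfl, rfl⟩
    exact ⟨w.2.1, ⟨w, w.2.2⟩, rfl, rfl⟩
  · rintro ⟨hx, w, rfl, rfl⟩
    exact ⟨⟨w, hx, w.2⟩, rfl, rfl⟩

theorem exists_of_mem_pcomp_graph {A B : H →ₗ.[ℂ] H} {x y : H} (h : (x, y) ∈ (pcomp A B).graph) :
    ∃ w, (x, w) ∈ B.graph ∧ (w, y) ∈ A.graph := by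
  obtain ⟨w, rfl, rfl⟩ := (LinearPMap.mem_graph_iff _).1 h
  obtain ⟨w, ⟨v, hv, hvw⟩, hw⟩ := w
  obtain rfl : (v : H) = w := hvw
  exact ⟨B v, B.mem_graph v, A.mem_graph ⟨B v, hv⟩⟩

/-- For an involution one inclusion suffices: applying `C` a second time brings `C x ∈ D(A)` back to
`x ∈ D(A)`. -/
theorem commutes_iff {A : H →ₗ.[ℂ] H} {C : H →L[ℂ] H} (hC : C * C = 1) :
    Commutes A C ↔ ∀ x y, (x, y) ∈ A.graph → (C x, C y) ∈ A.graph := by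
  constructor
  · intro h x y hxy
    obtain ⟨w, rfl, rfl⟩ := (LinearPMap.mem_graph_iff _).1 hxy
    have hw := (h.1 w).2 w.2
    exact (LinearPMap.mem_graph_iff _).2 ⟨⟨C w, hw⟩, rfl, h.2 w w.2 hw⟩
  · intro h
    have key : ∀ x ∈ A.domain, C x ∈ A.domain := fun x hx =>
      LinearPMap.mem_domain_of_mem_graph (h _ _ (A.mem_graph ⟨x, hx⟩))
    refine ⟨fun x => ⟨fun hx => ?_, key x⟩, fun x hx hCx => ?_⟩
    · have := key _ hx
      rwa [← mul_apply_eq_comp, hC] at this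
    · exact A.mem_graph_snd_inj (A.mem_graph ⟨C x, hCx⟩) (h _ _ (A.mem_graph ⟨x, hx⟩)) rfl

end Graphs

/-! ### The adjoint, the defect subspaces and the extension `A_μ`. -/

section Adjoint

variable [CompleteSpace H] {S : H →ₗ.[ℂ] H}

theorem mem_adjoint_graph (hd : Dense (S.domain : Set H)) {x y : H} :
    (x, y) ∈ S†.graph ↔ ∀ s t, (s, t) ∈ S.graph → inner ℂ y s = inner ℂ x t := by
  constructor
  · intro h s t hst
    obtain ⟨w, rfl, rfl⟩ := (LinearPMap.mem_graph_iff _).1 h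
    obtain ⟨v, rfl, rfl⟩ := (LinearPMap.mem_graph_iff _).1 hst
    exact LinearPMap.adjoint_isFormalAdjoint hd w v
  · intro h
    have h' : ∀ s : S.domain, inner ℂ y (s : H) = inner ℂ x (S s) :=
      fun s => h _ _ (S.mem_graph s)
    have hx := LinearPMap.mem_adjoint_domain_of_exists x ⟨y, h'⟩
    exact (LinearPMap.mem_graph_iff _).2
      ⟨⟨x, hx⟩, rfl, LinearPMap.adjoint_apply_eq hd ⟨x, hx⟩ h'⟩

theorem mem_defect {μ : ℂ} {x : H} : x ∈ defect S μ ↔ (x, μ • x) ∈ S†.graph := by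
  have : x ∈ defect S μ ↔ (x, (0 : H)) ∈ (shift S† μ).graph := by
    rw [LinearPMap.mem_graph_iff]
    constructor
    · rintro ⟨w, hw, rfl⟩
      exact ⟨w, rfl, hw⟩
    · rintro ⟨w, rfl, hw⟩
      exact ⟨w, hw, rfl⟩
  rw [this, mem_shift_graph, zero_add]

theorem mem_dissExt_graph {μ : ℂ} {x y : H} :
    (x, y) ∈ (dissExt S μ).graph ↔ x ∈ S.domain ⊔ defect S μ ∧ (x, y) ∈ S†.graph :=
  mem_domRestrict_graph

/-- The defect subspace is the orthogonal complement of `ran (S - μ̄)`. Its closedness and the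
decomposition of `H` both rest on this. -/
theorem mem_defect_iff_inner (hd : Dense (S.domain : Set H)) {μ : ℂ} {x : H} :
    x ∈ defect S μ ↔
      ∀ s t, (s, t) ∈ S.graph → inner ℂ x (t - (starRingEnd ℂ) μ • s) = 0 := by
  rw [mem_defect, mem_adjoint_graph hd]
  refine forall₃_congr fun s t _ => ?_
  rw [inner_sub_right, inner_smul_left, inner_smul_right, sub_eq_zero, eq_comm]

theorem isClosed_defect (hd : Dense (S.domain : Set H)) (μ : ℂ) :
    IsClosed (defect S μ : Set H) := by
  have : (defect S μ : Set H) = ⋂ p ∈ S.graph,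
      {x | inner ℂ x (p.2 - (starRingEnd ℂ) μ • p.1) = 0} := by
    ext x
    simp only [SetLike.mem_coe, mem_defect_iff_inner hd, Set.mem_iInter, Set.mem_ofPred_eq,
      Prod.forall]
  rw [this]
  exact isClosed_biInter fun p _ => isClosed_eq (by fun_prop) continuous_const

theorem graph_le_adjoint_graph (hd : Dense (S.domain : Set H)) (hs : S.IsFormalAdjoint S) :
    S.graph ≤ S†.graph :=
  LinearPMap.le_graph_of_le (hs.le_adjoint hd)

omit [CompleteSpace H] in
theorem inner_comm_of_symm (hs : S.IsFormalAdjoint S) {x y s t : H} (hx : (x, y) ∈ S.graph)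
    (ht : (s, t) ∈ S.graph) : inner ℂ y s = inner ℂ x t := by
  obtain ⟨w, rfl, rfl⟩ := (LinearPMap.mem_graph_iff _).1 hx
  obtain ⟨v, rfl, rfl⟩ := (LinearPMap.mem_graph_iff _).1 ht
  exact hs w v

/-- The extension `A_μ` has no eigenvalue in the lower half-plane. -/
theorem dissExt_injective (hd : Dense (S.domain : Set H)) (hs : S.IsFormalAdjoint S) {μ : ℂ}
    (hμ : 0 < μ.im) {w : H} (hw : (w, -Complex.I • w) ∈ (dissExt S μ).graph) : w = 0 := by
  obtain ⟨hw1, hw2⟩ := mem_dissExt_graph.1 hw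
  obtain ⟨s, hsd, n, hn, rfl⟩ := Submodule.mem_sup.1 hw1
  obtain ⟨t, ht⟩ : ∃ t, (s, t) ∈ S.graph := ⟨_, S.mem_graph ⟨s, hsd⟩⟩
  have hn' := mem_defect.1 hn
  have heq : -Complex.I • (s + n) = t + μ • n :=
    S†.mem_graph_snd_inj hw2
      (add_mem (graph_le_adjoint_graph hd hs ht) hn' : (s, t) + (n, μ • n) ∈ S†.graph) rfl
  have h1 : inner ℂ t s = inner ℂ s t := inner_comm_of_symm hs ht ht
  have h2 : inner ℂ (μ • n) s = inner ℂ n t := (mem_adjoint_graph hd).1 hn' s t ht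
  have h3 : inner ℂ (s + n) (-Complex.I • (s + n)) = inner ℂ (s + n) (t + μ • n) := by rw [heq]
  have h4 : (inner ℂ s t : ℂ).im = 0 := by
    have := congrArg Complex.im (inner_conj_symm (𝕜 := ℂ) s t)
    rw [h1, Complex.conj_im] at this
    linarith
  have h5 : (inner ℂ s (μ • n) : ℂ).im = -(inner ℂ n t : ℂ).im := by
    rw [← inner_conj_symm, Complex.conj_im, h2]
  have h6 := congrArg Complex.im h3
  rw [inner_smul_right, inner_self_eq_norm_sq_to_K, inner_add_left, inner_add_right,
    inner_add_right, inner_smul_right n n, inner_self_eq_norm_sq_to_K] at h6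
  simp only [Complex.add_im, h4, h5] at h6
  -- Dissipativity: in the imaginary part of `(A_μ w, w)` the `S`-term is real and the cross terms
  -- cancel, leaving `Im μ ‖n‖²`. The eigenvalue `-i` would make it `-‖w‖²`.
  have h7 : -‖s + n‖ ^ 2 = μ.im * ‖n‖ ^ 2 := by
    have e1 : (-Complex.I * ((‖s + n‖ : ℝ) : ℂ) ^ 2).im = -‖s + n‖ ^ 2 := by
      rw [← Complex.ofReal_pow, Complex.im_mul_ofReal]; simp
    have e2 : (μ * ((‖n‖ : ℝ) : ℂ) ^ 2).im = μ.im * ‖n‖ ^ 2 := by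
      rw [← Complex.ofReal_pow, Complex.im_mul_ofReal]
    have h6' : (-Complex.I * ((‖s + n‖ : ℝ) : ℂ) ^ 2).im =
      0 + -(inner ℂ n t : ℂ).im + ((inner ℂ n t : ℂ).im + (μ * ((‖n‖ : ℝ) : ℂ) ^ 2).im) := h6
    rw [e1, e2] at h6'
    linarith
  have h8 : ‖s + n‖ ^ 2 = 0 := by
    have : 0 ≤ μ.im * ‖n‖ ^ 2 := by positivity
    nlinarith [sq_nonneg ‖s + n‖]
  simpa using h8

/-- Parametrizes `Sh(μ)` by `w ∈ D(A_μ)`, as `(A_μ + i) w ↦ (A_μ - i) w`. Injectivity of `A_μ + i`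
is what makes `inverse` the true inverse. -/
theorem exists_of_mem_charFun_graph (hd : Dense (S.domain : Set H)) (hs : S.IsFormalAdjoint S)
    {μ : ℂ} (hμ : 0 < μ.im) {x y : H} (h : (x, y) ∈ (charFun S μ).graph) :
    ∃ w v, (w, v) ∈ (dissExt S μ).graph ∧ x = v + Complex.I • w ∧ y = v - Complex.I • w := by
  obtain ⟨w, h1, h2⟩ := exists_of_mem_pcomp_graph (mem_domRestrict_graph.1 h).2
  have hker : (shift (dissExt S μ) (-Complex.I)).toFun.ker = ⊥ := by
    refine LinearMap.ker_eq_bot'.2 fun m hm => Subtype.ext ?_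
    refine dissExt_injective hd hs hμ (w := (m : H)) ?_
    have := mem_shift_graph.1
      ((LinearPMap.mem_graph_iff _).2 ⟨m, rfl, hm⟩ :
        ((m : H), (0 : H)) ∈ (shift (dissExt S μ) (-Complex.I)).graph)
    simpa using this
  rw [LinearPMap.inverse_graph hker] at h1
  obtain ⟨⟨a, b⟩, hab, hab'⟩ := h1
  obtain ⟨rfl, rfl⟩ := Prod.mk.inj hab'
  refine ⟨a, b + -Complex.I • a, mem_shift_graph.1 hab, ?_, ?_⟩
  · change b = _
    module
  · have := (dissExt S μ).mem_graph_snd_inj (mem_shift_graph.1 h2) (mem_shift_graph.1 hab) rfl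
    rw [← this]; change y = _; module

end Adjoint

variable [CompleteSpace H] {S : H →ₗ.[ℂ] H}

/-! ### Closed range of `S ∓ i`. -/

section Range

-- The cross term vanishes because `(S s, s)` is real. The resulting lower bound makes the range of
-- `S - z` closed.
omit [CompleteSpace H] in
theorem norm_sub_I_smul_sq (hs : S.IsFormalAdjoint S) {z : ℂ} (hz : z = Complex.I ∨ z = -Complex.I)
    {s t : H} (h : (s, t) ∈ S.graph) : ‖t - z • s‖ ^ 2 = ‖t‖ ^ 2 + ‖s‖ ^ 2 := by
  have h1 : inner ℂ t s = inner ℂ s t := inner_comm_of_symm hs h h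
  have h4 : (inner ℂ t s : ℂ).im = 0 := by
    have := congrArg Complex.im (inner_conj_symm (𝕜 := ℂ) s t)
    rw [h1, Complex.conj_im] at this
    rw [h1]; linarith
  have hn : ‖z‖ = 1 := by rcases hz with rfl | rfl <;> simp
  have hre : (inner ℂ t (z • s) : ℂ).re = 0 := by
    rw [inner_smul_right]
    rcases hz with rfl | rfl <;> simp [h4]
  have := norm_sub_sq (𝕜 := ℂ) t (z • s)
  rw [norm_smul, hn, one_mul] at this
  rw [this]
  change ‖t‖ ^ 2 - 2 * (inner ℂ t (z • s) : ℂ).re + _ = _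
  rw [hre]; ring

/-- For `z = ±i` the space is the sum of the range of `S - z` and of the defect subspace
`ker (S* - z̄)`. -/
theorem exists_range_add_defect (hd : Dense (S.domain : Set H)) (hc : S.IsClosed)
    (hs : S.IsFormalAdjoint S) {z : ℂ} (hz : z = Complex.I ∨ z = -Complex.I) (h : H) :
    ∃ s t n, (s, t) ∈ S.graph ∧ n ∈ defect S ((starRingEnd ℂ) z) ∧ h = t - z • s + n := by
  have : CompleteSpace S.graph := IsClosed.completeSpace_coe (hs := hc)
  let L : S.graph →L[ℂ] H :=
    (ContinuousLinearMap.snd ℂ H H - z • ContinuousLinearMap.fst ℂ H H) ∘L S.graph.subtypeL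
  -- The constant is 1 because the product norm is the maximum of `‖s‖` and `‖t‖`. Completeness of
  -- the graph then closes the range.
  have hb : ∀ p : S.graph, ‖p‖ ≤ (1 : NNReal) * ‖L p‖ := by
    rintro ⟨⟨s, t⟩, hp⟩
    have hsq := norm_sub_I_smul_sq hs hz hp
    have e : ‖L ⟨(s, t), hp⟩‖ = ‖t - z • s‖ := rfl
    rw [NNReal.coe_one, one_mul, e]
    change max ‖s‖ ‖t‖ ≤ _
    refine max_le ?_ ?_ <;> refine le_of_sq_le_sq ?_ (norm_nonneg _) <;> rw [hsq] <;>
      nlinarith [sq_nonneg ‖s‖, sq_nonneg ‖t‖]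
  have hcl : IsClosed (L.range : Set H) := by
    rw [LinearMap.coe_range]
    exact (L.antilipschitz_of_bound hb).isClosed_range L.uniformContinuous
  have : CompleteSpace L.range := IsClosed.completeSpace_coe (hs := hcl)
  obtain ⟨y, ⟨p, rfl⟩, n, hn, rfl⟩ := L.range.exists_add_mem_mem_orthogonal h
  refine ⟨p.1.1, p.1.2, n, p.2, ?_, rfl⟩
  rw [mem_defect_iff_inner hd]
  intro s t hst
  rw [Complex.conj_conj]
  exact (Submodule.mem_orthogonal' _ _).1 hn _ ⟨⟨(s, t), hst⟩, rfl⟩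

end Range

/-! ### Von Neumann's self-adjoint extension. -/

section UnitaryExtension

/-- The extension of `S` whose Cayley transform extends the operator `-U` from the defect subspace
`𝔑_i` to the defect subspace `𝔑_{-i}`. -/
noncomputable def cayleyExt (S : H →ₗ.[ℂ] H) (U : defect S Complex.I →L[ℂ] defect S (-Complex.I)) :
    H →ₗ.[ℂ] H :=
  S†.domRestrict (S.domain ⊔ LinearMap.range
    ((defect S Complex.I).subtype + (defect S (-Complex.I)).subtype ∘ₗ U.toLinearMap))

variable {U : defect S Complex.I →L[ℂ] defect S (-Complex.I)}

theorem mem_cayleyExt_graph (hd : Dense (S.domain : Set H)) (hs : S.IsFormalAdjoint S) {x y : H} :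
    (x, y) ∈ (cayleyExt S U).graph ↔ ∃ s t, (s, t) ∈ S.graph ∧ ∃ n : defect S Complex.I,
      x = s + (n + U n) ∧ y = t + Complex.I • ((n : H) - U n) := by
  have key : ∀ s t, (s, t) ∈ S.graph → ∀ n : defect S Complex.I,
      (s + (n + U n), t + Complex.I • ((n : H) - U n)) ∈ S†.graph := by
    intro s t hst n
    have := add_mem (graph_le_adjoint_graph hd hs hst)
      (add_mem (mem_defect.1 n.2) (mem_defect.1 (U n).2))
    convert! this using 1
    refine Prod.ext rfl ?_
    change _ = t + (Complex.I • (n : H) + -Complex.I • (U n : H))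
    module
  rw [cayleyExt, mem_domRestrict_graph]
  constructor
  · rintro ⟨hx, hxy⟩
    obtain ⟨s, hsd, _, ⟨n, rfl⟩, rfl⟩ := Submodule.mem_sup.1 hx
    exact ⟨s, _, S.mem_graph ⟨s, hsd⟩, n, rfl,
      S†.mem_graph_snd_inj hxy (key _ _ (S.mem_graph ⟨s, hsd⟩) n) rfl⟩
  · rintro ⟨s, t, hst, n, rfl, rfl⟩
    exact ⟨Submodule.add_mem_sup (LinearPMap.mem_domain_of_mem_graph hst) ⟨n, rfl⟩, key s t hst n⟩

theorem le_cayleyExt (hd : Dense (S.domain : Set H)) (hs : S.IsFormalAdjoint S) :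
    S ≤ cayleyExt S U := by
  refine LinearPMap.le_of_le_graph ?_
  rintro ⟨s, t⟩ h
  exact (mem_cayleyExt_graph hd hs).2 ⟨s, t, h, 0, by simp, by simp⟩

/-- Terms involving `S` cancel because `S*` acts on the defect vectors; what remains is the
difference of `(n, n')` and `(U n, U n')`, which is zero for isometric `U`. -/
theorem cayleyExt_symm (hd : Dense (S.domain : Set H)) (hs : S.IsFormalAdjoint S)
    (hU : ∀ x y, inner ℂ (U x) (U y) = inner ℂ x y) {x y x' y' : H}
    (h : (x, y) ∈ (cayleyExt S U).graph) (h' : (x', y') ∈ (cayleyExt S U).graph) :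
    inner ℂ y x' = inner ℂ x y' := by
  obtain ⟨s, t, hst, n, rfl, rfl⟩ := (mem_cayleyExt_graph hd hs).1 h
  obtain ⟨s', t', hst', n', rfl, rfl⟩ := (mem_cayleyExt_graph hd hs).1 h'
  have key : ∀ {s t : H}, (s, t) ∈ S.graph → ∀ n : defect S Complex.I,
      inner ℂ (Complex.I • ((n : H) - U n)) s = inner ℂ ((n : H) + U n) t := by
    intro s t hst n
    have h1 := (mem_adjoint_graph hd).1 (mem_defect.1 n.2) s t hst
    have h2 := (mem_adjoint_graph hd).1 (mem_defect.1 (U n).2) s t hst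
    rw [inner_add_left, ← h1, ← h2, ← inner_add_left]
    congr 1
    module
  have k1 := inner_comm_of_symm hs hst hst'
  have k2 := key hst' n
  have k3 : inner ℂ t ((n' : H) + U n') = inner ℂ s (Complex.I • ((n' : H) - U n')) := by
    rw [← inner_conj_symm, ← key hst n', inner_conj_symm]
  have k4 : inner ℂ (Complex.I • ((n : H) - U n)) ((n' : H) + U n') =
      inner ℂ ((n : H) + U n) (Complex.I • ((n' : H) - U n')) := by
    have hU' : inner ℂ (U n : H) (U n' : H) = inner ℂ (n : H) (n' : H) := hU n n'
    simp only [inner_smul_left, inner_smul_right, inner_add_left, inner_add_right, inner_sub_left,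
      inner_sub_right, Complex.conj_I, hU']
    ring
  rw [inner_add_left, inner_add_left s, inner_add_right t, inner_add_right (Complex.I • _),
    inner_add_right s, inner_add_right ((n : H) + _), k1, k2, k3, k4]

/-- The range of `S - z` misses only a defect subspace, and the new vectors fill it: `(A - i)(n + U
n) = -2i U n` and `(A + i)(n + U n) = 2i n`. These give the factors `∓(2i)⁻¹` in the witnesses. -/
theorem cayleyExt_surjective (hd : Dense (S.domain : Set H)) (hc : S.IsClosed)
    (hs : S.IsFormalAdjoint S) (hU : Function.Surjective U) {z : ℂ}
    (hz : z = Complex.I ∨ z = -Complex.I) (h : H) :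
    ∃ x y, (x, y) ∈ (cayleyExt S U).graph ∧ y - z • x = h := by
  obtain ⟨s, t, n, hst, hn, rfl⟩ := exists_range_add_defect hd hc hs hz h
  have hI : (2 * Complex.I)⁻¹ * (2 * Complex.I) = 1 := inv_mul_cancel₀ (by simp)
  rcases hz with rfl | rfl
  · rw [Complex.conj_I] at hn
    obtain ⟨m, hm⟩ := hU (-(2 * Complex.I)⁻¹ • ⟨n, hn⟩)
    refine ⟨_, _, (mem_cayleyExt_graph hd hs).2 ⟨s, t, hst, m, rfl, rfl⟩, ?_⟩
    rw [hm]
    change t + Complex.I • ((m : H) - -(2 * Complex.I)⁻¹ • n) -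
      Complex.I • (s + (m + -(2 * Complex.I)⁻¹ • n)) = _
    have : n = ((2 * Complex.I)⁻¹ * (2 * Complex.I)) • n := by rw [hI, one_smul]
    nth_rw 3 [this]
    module
  · rw [map_neg, Complex.conj_I, neg_neg] at hn
    refine ⟨_, _, (mem_cayleyExt_graph hd hs).2
      ⟨s, t, hst, (2 * Complex.I)⁻¹ • ⟨n, hn⟩, rfl, rfl⟩, ?_⟩
    generalize U _ = m
    change t + Complex.I • ((2 * Complex.I)⁻¹ • n - (m : H)) -
      -Complex.I • (s + ((2 * Complex.I)⁻¹ • n + m)) = _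
    have : n = ((2 * Complex.I)⁻¹ * (2 * Complex.I)) • n := by rw [hI, one_smul]
    nth_rw 3 [this]
    module

/-- The extension of `S` determined by a unitary operator between the defect subspaces is
self-adjoint. -/
theorem mem_cayleyExt_graph_iff_inner (hd : Dense (S.domain : Set H)) (hc : S.IsClosed)
    (hs : S.IsFormalAdjoint S) (hU : ∀ x y, inner ℂ (U x) (U y) = inner ℂ x y)
    (hUs : Function.Surjective U) {y z : H} :
    (y, z) ∈ (cayleyExt S U).graph ↔
      ∀ x x', (x, x') ∈ (cayleyExt S U).graph → inner ℂ y x' = inner ℂ z x := by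
  refine ⟨fun h x x' hx => (cayleyExt_symm hd hs hU h hx).symm, fun h => ?_⟩
  -- Choose `w` with `(A - i) w = z - i y`. Then `y - w` is orthogonal to `ran (A + i)`, which is
  -- all of `H`, so testing against `(A + i) v = y - w` gives `y = w`.
  obtain ⟨w, w', hw, hww⟩ :=
    cayleyExt_surjective hd hc hs hUs (Or.inl rfl) (z - Complex.I • y)
  obtain ⟨v, v', hv, hvv⟩ := cayleyExt_surjective hd hc hs hUs (Or.inr rfl) (y - w)
  have h1 := h v v' hv
  have h2 := cayleyExt_symm hd hs hU hw hv
  have hzw : z - w' = Complex.I • (y - w) := by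
    have := congrArg (fun u => z - Complex.I • w - u) hww
    rw [sub_eq_iff_eq_add.1 hww]; module
  have h3 : inner ℂ (y - w) (v' - -Complex.I • v) = 0 := by
    have e : inner ℂ (y - w) v' = inner ℂ (z - w') v := by
      rw [inner_sub_left, inner_sub_left, h1, h2]
    rw [inner_sub_right, e, hzw, inner_smul_left, inner_smul_right, Complex.conj_I, sub_self]
  rw [hvv, inner_self_eq_zero, sub_eq_zero] at h3
  subst h3
  rw [sub_self, smul_zero, sub_eq_zero] at hzw
  rwa [hzw]

end UnitaryExtension

/-! ### Operators commuting with `S`. -/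

section Commutation

/-- Moving `C` across the inner product puts `C*` on the graph of `S`, which is why the condition
falls on `C*`. -/
theorem adjoint_graph_map (hd : Dense (S.domain : Set H)) {C : H →L[ℂ] H}
    (hC : ∀ x y, (x, y) ∈ S.graph → (adjoint C x, adjoint C y) ∈ S.graph) {x y : H}
    (h : (x, y) ∈ S†.graph) : (C x, C y) ∈ S†.graph := by
  rw [mem_adjoint_graph hd] at h ⊢
  intro s t hst
  rw [← ContinuousLinearMap.adjoint_inner_right, ← ContinuousLinearMap.adjoint_inner_right]
  exact h _ _ (hC _ _ hst)

theorem map_mem_defect (hd : Dense (S.domain : Set H)) {C : H →L[ℂ] H}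
    (hC : ∀ x y, (x, y) ∈ S.graph → (adjoint C x, adjoint C y) ∈ S.graph) {μ : ℂ} {x : H}
    (h : x ∈ defect S μ) : C x ∈ defect S μ := by
  rw [mem_defect] at h ⊢
  simpa using adjoint_graph_map hd hC h

/-- `C` preserves the graph of `A_μ`, so `C w` and `w'` both solve `(A_μ + i) u = C x`; injectivity
of `A_μ + i` makes them equal. -/
theorem charFun_intertwines (hd : Dense (S.domain : Set H)) (hs : S.IsFormalAdjoint S)
    {C : H →L[ℂ] H}
    (hC : ∀ x y, (x, y) ∈ S.graph → (C x, C y) ∈ S.graph)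
    (hC' : ∀ x y, (x, y) ∈ S.graph → (adjoint C x, adjoint C y) ∈ S.graph) {μ : ℂ}
    (hμ : 0 < μ.im) {x y y' : H} (h : (x, y) ∈ (charFun S μ).graph)
    (h' : (C x, y') ∈ (charFun S μ).graph) : y' = C y := by
  obtain ⟨w, v, hwv, rfl, rfl⟩ := exists_of_mem_charFun_graph hd hs hμ h
  obtain ⟨w', v', hwv', hx, rfl⟩ := exists_of_mem_charFun_graph hd hs hμ h'
  have hCw : (C w, C v) ∈ (dissExt S μ).graph := by
    rw [mem_dissExt_graph] at hwv ⊢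
    refine ⟨?_, adjoint_graph_map hd hC' hwv.2⟩
    obtain ⟨s, hsd, n, hn, rfl⟩ := Submodule.mem_sup.1 hwv.1
    rw [map_add]
    exact Submodule.add_mem_sup
      (LinearPMap.mem_domain_of_mem_graph (hC _ _ (S.mem_graph ⟨s, hsd⟩)))
      (map_mem_defect hd hC' hn)
  rw [map_add, map_smul] at hx
  have hv : v' - C v = -Complex.I • (w' - C w) := by
    rw [eq_sub_of_add_eq hx]
    module
  have h0 : (w' - C w, v' - C v) ∈ (dissExt S μ).graph := sub_mem hwv' hCw
  have hw0 : w' - C w = 0 := dissExt_injective hd hs hμ (hv ▸ h0)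
  rw [hw0, smul_zero, sub_eq_zero] at hv
  rw [hv, sub_eq_zero.1 hw0, map_sub, map_smul]

/-- The restriction of a bounded operator to an invariant subspace. -/
def compress (C : H →L[ℂ] H) (V : Submodule ℂ H) (h : ∀ x ∈ V, C x ∈ V) : V →L[ℂ] V :=
  (C ∘L V.subtypeL).codRestrict V fun x => h x x.2

theorem adjoint_compress {C : H →L[ℂ] H} {V : Submodule ℂ H} [CompleteSpace V]
    (h : ∀ x ∈ V, C x ∈ V) (h' : ∀ x ∈ V, adjoint C x ∈ V) :
    adjoint (compress C V h) = compress (adjoint C) V h' := by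
  symm
  rw [ContinuousLinearMap.eq_adjoint_iff]
  intro x y
  exact ContinuousLinearMap.adjoint_inner_left C (y : H) (x : H)

/-- If some value of the characteristic function is boundedly invertible, then the defect subspaces
are unitarily equivalent by an operator that commutes with every bounded operator which, together
with its adjoint, commutes with `S`. -/
theorem exists_unitary_defect (hd : Dense (S.domain : Set H)) (hs : S.IsFormalAdjoint S) {μ : ℂ}
    (hμ : 0 < μ.im) (he : CharFunBoundedlyInvertible S μ) :
    ∃ U : defect S Complex.I →L[ℂ] defect S (-Complex.I),
      (∀ x y, inner ℂ (U x) (U y) = inner ℂ x y) ∧ Function.Surjective U ∧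
      ∀ C : H →L[ℂ] H, (∀ x y, (x, y) ∈ S.graph → (C x, C y) ∈ S.graph) →
        (∀ x y, (x, y) ∈ S.graph → (adjoint C x, adjoint C y) ∈ S.graph) →
        ∀ x x' : defect S Complex.I, (x' : H) = C x → (U x' : H) = C (U x) := by
  obtain ⟨e, he⟩ := he
  have : ∀ z, CompleteSpace (defect S z) :=
    fun z => IsClosed.completeSpace_coe (hs := isClosed_defect hd z)
  obtain ⟨U, hU1, hU2, hU3⟩ := exists_unitary_intertwining e
  refine ⟨U, hU1, hU2, fun C hC hC' x x' hx => ?_⟩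
  have hC'' : ∀ x y, (x, y) ∈ S.graph →
      (adjoint (adjoint C) x, adjoint (adjoint C) y) ∈ S.graph := by
    simpa using hC
  have hm := fun (z : ℂ) (x : H) => map_mem_defect hd hC' (μ := z) (x := x)
  have hm' := fun (z : ℂ) (x : H) => map_mem_defect hd hC'' (μ := z) (x := x)
  have := hU3 (compress C _ (hm Complex.I)) (compress C _ (hm (-Complex.I)))
    (fun x => Subtype.ext (charFun_intertwines hd hs hC hC' hμ (he x)
      (he (compress C _ (hm _) x))))
    (fun x => by
      rw [adjoint_compress _ (hm' _), adjoint_compress _ (hm' _)]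
      exact Subtype.ext (charFun_intertwines hd hs hC' hC'' hμ (he x)
        (he (compress (adjoint C) _ (hm' _) x)))) x
  rw [show x' = compress C _ (hm Complex.I) x from Subtype.ext hx, this]
  rfl

theorem cayleyExt_graph_map (hd : Dense (S.domain : Set H)) (hs : S.IsFormalAdjoint S)
    {U : defect S Complex.I →L[ℂ] defect S (-Complex.I)} {C : H →L[ℂ] H}
    (hC : ∀ x y, (x, y) ∈ S.graph → (C x, C y) ∈ S.graph)
    (hC' : ∀ x y, (x, y) ∈ S.graph → (adjoint C x, adjoint C y) ∈ S.graph)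
    (hU : ∀ x x' : defect S Complex.I, (x' : H) = C x → (U x' : H) = C (U x)) (x y : H)
    (h : (x, y) ∈ (cayleyExt S U).graph) : (C x, C y) ∈ (cayleyExt S U).graph := by
  obtain ⟨s, t, hst, n, rfl, rfl⟩ := (mem_cayleyExt_graph hd hs).1 h
  refine (mem_cayleyExt_graph hd hs).2
    ⟨C s, C t, hC _ _ hst, ⟨C n, map_mem_defect hd hC' n.2⟩, ?_, ?_⟩ <;>
  simp [hU n ⟨C n, map_mem_defect hd hC' n.2⟩ rfl]

end Commutation

end KreinExt

/-! ### The extension commuting with all `C`-symmetries. -/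

theorem theorem2p1 {H : Type*} [NormedAddCommGroup H] [InnerProductSpace ℂ H] [CompleteSpace H]
    (J : H →L[ℂ] H) (hJ : KreinExt.IsFundamentalSymmetry J)
    (S : H →ₗ.[ℂ] H) (hS_dense : Dense (S.domain : Set H)) (hS_closed : S.IsClosed)
    (hS_symm : S.IsFormalAdjoint S) (hSJ : KreinExt.Commutes S J)
    (hSh : ∃ μ : ℂ, 0 < μ.im ∧ KreinExt.CharFunBoundedlyInvertible S μ) :
    (KreinExt.upsilonU J S).Nonempty := by
  obtain ⟨μ, hμ, he⟩ := hSh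
  obtain ⟨hJa, hJJ⟩ := hJ
  replace hJa : adjoint J = J := hJa
  obtain ⟨U, hU, hUs, hUC⟩ := KreinExt.exists_unitary_defect hS_dense hS_symm hμ he
  have hJS := (KreinExt.commutes_iff hJJ).1 hSJ
  have hJS' : ∀ x y, (x, y) ∈ S.graph → (adjoint J x, adjoint J y) ∈ S.graph := by rwa [hJa]
  have hJA := KreinExt.cayleyExt_graph_map hS_dense hS_symm hJS hJS' (hUC J hJS hJS')
  have hJJ' : ∀ x, J (J x) = x := fun x => DFunLike.congr_fun hJJ x
  have hle : S ≤ KreinExt.cayleyExt S U := KreinExt.le_cayleyExt hS_dense hS_symm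
  refine ⟨KreinExt.cayleyExt S U, ⟨hle, hS_dense.mono hle.1, fun y z => ?_⟩, ?_⟩
  -- `J` maps the graph of the extension onto itself, so replacing the test pair `(x, A x)` by `(J
  -- x, J A x)` trades the inner product for the Krein form.
  · rw [KreinExt.mem_cayleyExt_graph_iff_inner hS_dense hS_closed hS_symm hU hUs]
    constructor
    · rintro h ⟨x, hx⟩
      exact h _ _ (hJA _ _ (LinearPMap.mem_graph _ ⟨x, hx⟩))
    · intro h x x' hx
      obtain ⟨w, hw, hw'⟩ := (LinearPMap.mem_graph_iff _).1 (hJA _ _ hx)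
      have := h w
      rwa [hw, hw', KreinExt.krein, KreinExt.krein, hJJ', hJJ'] at this
  · rintro C ⟨hCC, ⟨hJC, -⟩, hSC⟩
    have hCS := (KreinExt.commutes_iff hCC).1 hSC
    -- Positivity of `J C` includes self-adjointness, `C* J = J C`; multiply by `J` on the right.
    have hCa : adjoint C = J * C * J := by
      have h1 : star C * star J = J * C := by rw [← star_mul]; exact hJC.isSelfAdjoint
      rw [show star J = J from hJa] at h1
      change star C = _
      rw [← h1, mul_assoc, hJJ, mul_one]
    have hCS' : ∀ x y, (x, y) ∈ S.graph → (adjoint C x, adjoint C y) ∈ S.graph := by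
      rw [hCa]
      exact fun x y h => hJS _ _ (hCS _ _ (hJS _ _ h))
    exact (KreinExt.commutes_iff hCC).2
      (KreinExt.cayleyExt_graph_map hS_dense hS_symm hCS hCS' (hUC C hCS hCS'))
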